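/- **Setting.** Let $\mathbb F$ be an algebraically closed field, let $d\ge 3$, and let $V$ be a vector space over $\mathbb F$ of dimension $d+1$. A *Leonard pair* on $V$ is an ordered pair $A,A^*\in\mathrm{End}(V)$ such that there is a basis of $V$ in which $A$ is irreducible tridiagonal and $A^*$ is diagonal, and a basis in which $A^*$ is irreducible tridiagonal and $A$ is diagonal (a matrix is irreducible tridiagonal if all entries off the three central diagonals vanish and all entries on the sub- and superdiagonal are nonzero). The eigenvalues of $A$ are then pairwise distinct. An ordering $\theta_0,\dots,\theta_d$ of them is *standard* if corresponding eigenvectors $v_0,\dots,v_d$ form a basis in which $A^*$ is irreducible tridiagonal; the ordering $E_0,\dots,E_d$ of the associated primitive idempotents of $A$ ($E_i$ is the projection onto the $\theta_i$-eigenspace along the other eigenspaces) is then also called standard; similarly with $A,A^*$ exchanged. A *Leonard system* on $V$ is a sequence $\Phi=(A;\{E_i\}_{i=0}^d;A^*;\{E^*_i\}_{i=0}^d)$ where $A,A^*$ is a Leonard pair on $V$ and $\{E_i\}$, $\{E_i^*\}$ are standard orderings of the primitive idempotents of $A$, $A^*$. Let $\theta_i$ (resp. $\theta^*_i$) be the eigenvalue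 of $A$ (resp. $A^*$) associated with $E_i$ (resp. $E^*_i$). For $0\ne u\in E_0^*V$ the vectors $u_i=(A-\theta_0I)\cdots(A-\theta_{i-1}I)u$ $(0\le i\le d)$ form a basis of $V$ in which $A$ is lower bidiagonal with diagonal $\theta_0,\dots,\theta_d$ and all subdiagonal entries $1$, and $A^*$ is upper bidiagonal with diagonal $\theta_0^*,\dots,\theta_d^*$ and superdiagonal entries $\varphi_1,\dots,\varphi_d$. The sequence $\{\varphi_i\}_{i=1}^d$ is the *first split sequence* of $\Phi$. The *second split sequence* $\{\phi_i\}_{i=1}^d$ of $\Phi$ is the first split sequence of $(A;\{E_{d-i}\}_{i=0}^d;A^*;\{E^*_i\}_{i=0}^d)$. The *zero diagonal space* $\mathcal Z(\Phi)$ is the set of all $X\in\mathrm{Span}\{I,A^*,A,AA^*\}$ such that $E^*_iXE^*_i=0$ for $0\le i\le d$. **Types.** In each case the formulas for $\theta_i,\theta_i^*$ hold for $0\le i\le d$, and those for $\varphi_i,\phi_i$ for $1\le i\le d$. * $\Phi$ has *dual $q$-Hahn type* if there are nonzero $q,h,h^*,s,r\in\mathbb F$ such that none of $q^i,\,rq^i,\,sq^i/r$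 equals $1$ for $1\le i\le d$, $sq^i\ne1$ for $2\le i\le 2d$, and $\theta_i=\theta_0+h(1-q^i)(1-sq^{i+1})q^{-i}$, $\theta_i^*=\theta_0^*+h^*(1-q^i)q^{-i}$, $\varphi_i=hh^*q^{1-2i}(1-q^i)(1-q^{i-d-1})(1-rq^i)$, $\phi_i=hh^*q^{d+2-2i}(1-q^i)(1-q^{i-d-1})(s-rq^{i-d-1})$. * $\Phi$ has *quantum $q$-Krawtchouk type* if there are nonzero $q,h^*,s,r\in\mathbb F$ such that $q^i\ne1$ and $sq^i/r\ne1$ for $1\le i\le d$, and $\theta_i=\theta_0-sq(1-q^i)$, $\theta_i^*=\theta_0^*+h^*(1-q^i)q^{-i}$, $\varphi_i=-rh^*q^{1-i}(1-q^i)(1-q^{i-d-1})$, $\phi_i=h^*q^{d+2-2i}(1-q^i)(1-q^{i-d-1})(s-rq^{i-d-1})$. * $\Phi$ has *$q$-Krawtchouk type* if there are nonzero $q,h,h^*,s^*\in\mathbb F$ such that $q^i\ne1$ for $1\le i\le d$, $s^*q^i\ne1$ for $2\le i\le2d$, and $\theta_i=\theta_0+h(1-q^i)q^{-i}$, $\theta_i^*=\theta_0^*+h^*(1-q^i)(1-s^*q^{i+1})q^{-i}$,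 $\varphi_i=hh^*q^{1-2i}(1-q^i)(1-q^{i-d-1})$, $\phi_i=hh^*s^*q(1-q^i)(1-q^{i-d-1})$. * $\Phi$ has *affine $q$-Krawtchouk type* if there are nonzero $q,h,h^*,r\in\mathbb F$ such that $q^i\ne1$ and $rq^i\ne1$ for $1\le i\le d$, and $\theta_i=\theta_0+h(1-q^i)q^{-i}$, $\theta_i^*=\theta_0^*+h^*(1-q^i)q^{-i}$, $\varphi_i=hh^*q^{1-2i}(1-q^i)(1-q^{i-d-1})(1-rq^i)$, $\phi_i=-hh^*rq^{1-i}(1-q^i)(1-q^{i-d-1})$. * $\Phi$ has *dual Hahn type* if the characteristic of $\mathbb F$ is $0$ or a prime greater than $d$ and there are $h,s,s^*,r\in\mathbb F$ with $h,s^*$ nonzero such that neither of $r,\,s-r$ equals $-i$ for $1\le i\le d$, $s\ne-i$ for $2\le i\le2d$, and $\theta_i=\theta_0+hi(i+1+s)$, $\theta_i^*=\theta_0^*+s^*i$, $\varphi_i=hs^*i(i-d-1)(i+r)$, $\phi_i=hs^*i(i-d-1)(i+r-s-d-1)$. * $\Phi$ has *Orphan type* if $d=3$, $\mathbb F$ has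 characteristic $2$, and there are nonzero $h,h^*,s,s^*,r\in\mathbb F$ such that $s\ne1$, $s^*\ne1$, $r$ is none of $s+s^*,\,s(1+s^*),\,s^*(1+s)$, and $\theta_1=\theta_0+h(s+1)$, $\theta_2=\theta_0+h$, $\theta_3=\theta_0+hs$, $\theta^*_1=\theta^*_0+h^*(s^*+1)$, $\theta^*_2=\theta^*_0+h^*$, $\theta^*_3=\theta^*_0+h^*s^*$, $\varphi_1=hh^*r$, $\varphi_2=hh^*$, $\varphi_3=hh^*(r+s+s^*)$, $\phi_1=hh^*(r+s+ss^*)$, $\phi_2=hh^*$, $\phi_3=hh^*(r+s^*+ss^*)$. **Theorem.** Let $\Phi$ be a Leonard system on $V$ (with $\mathbb F$ algebraically closed and $d\ge3$) that has dual $q$-Hahn, quantum $q$-Krawtchouk, $q$-Krawtchouk, affine $q$-Krawtchouk, dual Hahn, or Orphan type. Then $\mathcal Z(\Phi)=0$. -/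

import Mathlib

/-- A square matrix is irreducible tridiagonal: every entry off the three central diagonals is
zero, and every entry on the subdiagonal and on the superdiagonal is nonzero. -/
def IsIrreducibleTridiagonal {F : Type*} [Field F] {n : ℕ} (M : Matrix (Fin n) (Fin n) F) :
    Prop :=
  ∀ i j : Fin n,
    (((i : ℕ) + 1 < (j : ℕ) ∨ (j : ℕ) + 1 < (i : ℕ)) → M i j = 0) ∧
    (((i : ℕ) + 1 = (j : ℕ) ∨ (j : ℕ) + 1 = (i : ℕ)) → M i j ≠ 0)

/-- `A, B` is a Leonard pair on `V`, where `dim V = d + 1`. -/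
def IsLeonardPair {F V : Type*} [Field F] [AddCommGroup V] [Module F V] (d : ℕ)
    (A B : Module.End F V) : Prop :=
  (∃ b : Module.Basis (Fin (d + 1)) F V,
    IsIrreducibleTridiagonal (LinearMap.toMatrix b b A) ∧ (LinearMap.toMatrix b b B).IsDiag) ∧
  (∃ b : Module.Basis (Fin (d + 1)) F V,
    IsIrreducibleTridiagonal (LinearMap.toMatrix b b B) ∧ (LinearMap.toMatrix b b A).IsDiag)

/-- `θ 0, …, θ d` is an ordering (without repetition) of all the eigenvalues of `A`. -/
def IsEigenvalueOrdering {F V : Type*} [Field F] [AddCommGroup V] [Module F V] {d : ℕ}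
    (A : Module.End F V) (θ : Fin (d + 1) → F) : Prop :=
  Function.Injective θ ∧ ∀ μ : F, A.HasEigenvalue μ ↔ ∃ i, θ i = μ

/-- The ordering `θ` of the eigenvalues of `A` is standard (with respect to `B`): eigenvectors
`v i` for `θ i` form a basis in which `B` is represented by an irreducible tridiagonal matrix. -/
def IsStandardOrdering {F V : Type*} [Field F] [AddCommGroup V] [Module F V] {d : ℕ}
    (A B : Module.End F V) (θ : Fin (d + 1) → F) : Prop :=
  IsEigenvalueOrdering A θ ∧
  ∃ v : Module.Basis (Fin (d + 1)) F V,
    (∀ i, A.HasEigenvector (θ i) (v i)) ∧ IsIrreducibleTridiagonal (LinearMap.toMatrix v v B)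

/-- For each `i`, `E i` is the primitive idempotent of `A` associated with `θ i`: it acts as the
identity on the `θ i`-eigenspace and as zero on the other eigenspaces. -/
def ArePrimitiveIdempotents {F V : Type*} [Field F] [AddCommGroup V] [Module F V] {d : ℕ}
    (A : Module.End F V) (θ : Fin (d + 1) → F) (E : Fin (d + 1) → Module.End F V) : Prop :=
  ∀ i j, ∀ v ∈ A.eigenspace (θ j), E i v = if i = j then v else 0

/-- `E 0, …, E d` is a standard ordering of the primitive idempotents of `A`
(with respect to `B`). -/
def IsStandardIdempotentOrdering {F V : Type*} [Field F] [AddCommGroup V] [Module F V] {d : ℕ}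
    (A B : Module.End F V) (E : Fin (d + 1) → Module.End F V) : Prop :=
  ∃ θ : Fin (d + 1) → F, IsStandardOrdering A B θ ∧ ArePrimitiveIdempotents A θ E

/-- A Leonard system `(A; {E i}; A*; {E* i})` on `V`. -/
structure LeonardSystem (F V : Type*) [Field F] [AddCommGroup V] [Module F V] (d : ℕ) where
  A : Module.End F V
  E : Fin (d + 1) → Module.End F V
  Astar : Module.End F V
  Estar : Fin (d + 1) → Module.End F V
  isLeonardPair : IsLeonardPair d A Astar
  standard : IsStandardIdempotentOrdering A Astar E
  standardStar : IsStandardIdempotentOrdering Astar A Estar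

/-- Reversing a standard ordering of the primitive idempotents gives a standard ordering. -/
theorem IsStandardIdempotentOrdering.rev {F V : Type*} [Field F] [AddCommGroup V] [Module F V]
    {d : ℕ} {A B : Module.End F V} {E : Fin (d + 1) → Module.End F V}
    (h : IsStandardIdempotentOrdering A B E) :
    IsStandardIdempotentOrdering A B (fun i => E i.rev) := by
  obtain ⟨θ, ⟨⟨hinj, hev⟩, v, hv, hB⟩, hE⟩ := h
  refine ⟨fun i => θ i.rev, ⟨⟨fun i j hij => Fin.rev_injective (hinj hij), fun μ => ?_⟩,
    v.reindex Fin.revPerm, fun i => ?_, ?_⟩, fun i j w hw => ?_⟩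
  · rw [hev]
    constructor
    · rintro ⟨i, hi⟩
      exact ⟨i.rev, by simpa using hi⟩
    · rintro ⟨i, hi⟩
      exact ⟨i.rev, hi⟩
  · simpa using hv i.rev
  · intro i j
    have key : LinearMap.toMatrix (v.reindex Fin.revPerm) (v.reindex Fin.revPerm) B i j =
        LinearMap.toMatrix v v B i.rev j.rev := by
      simp [LinearMap.toMatrix_apply]
    have h := hB i.rev j.rev
    rw [Fin.val_rev, Fin.val_rev] at h
    rw [key]
    have hi := i.isLt
    have hj := j.isLt
    exact ⟨fun h' => h.1 (by omega), fun h' => h.2 (by omega)⟩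
  · simpa [Fin.rev_inj] using hE i.rev j.rev w hw

namespace LeonardSystem

variable {F V : Type*} [Field F] [AddCommGroup V] [Module F V] {d : ℕ}

/-- The eigenvalue sequence: `Φ.eigenvalue i` is the eigenvalue of `A` associated with `E i`
(it is determined by `Φ`, as `E i` is a nonzero map and `A * E i = θ i • E i`). -/
noncomputable def eigenvalue (Φ : LeonardSystem F V d) : Fin (d + 1) → F :=
  Φ.standard.choose

/-- The dual eigenvalue sequence: `Φ.dualEigenvalue i` is the eigenvalue of `A*` associated with
`E* i`. -/
noncomputable def dualEigenvalue (Φ : LeonardSystem F V d) : Fin (d + 1) → F :=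
  Φ.standardStar.choose

theorem eigenvalue_spec (Φ : LeonardSystem F V d) :
    IsStandardOrdering Φ.A Φ.Astar Φ.eigenvalue ∧
      ArePrimitiveIdempotents Φ.A Φ.eigenvalue Φ.E :=
  Φ.standard.choose_spec

theorem dualEigenvalue_spec (Φ : LeonardSystem F V d) :
    IsStandardOrdering Φ.Astar Φ.A Φ.dualEigenvalue ∧
      ArePrimitiveIdempotents Φ.Astar Φ.dualEigenvalue Φ.Estar :=
  Φ.standardStar.choose_spec

/-- The Leonard system `Φ^⇓ = (A; {E (d - i)}; A*; {E* i})`. -/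
def ddown (Φ : LeonardSystem F V d) : LeonardSystem F V d where
  A := Φ.A
  E := fun i => Φ.E i.rev
  Astar := Φ.Astar
  Estar := Φ.Estar
  isLeonardPair := Φ.isLeonardPair
  standard := Φ.standard.rev
  standardStar := Φ.standardStar

/-- The polynomial `τ_i(x) = (x - θ_0)(x - θ_1) ⋯ (x - θ_{i-1})`. -/
noncomputable def tau (Φ : LeonardSystem F V d) (i : Fin (d + 1)) : Polynomial F :=
  ∏ j ∈ Finset.univ.filter (fun j => j < i), (Polynomial.X - Polynomial.C (Φ.eigenvalue j))

/-- `b` is a `Φ`-split basis: `b i = τ_i(A) u` for some nonzero `u ∈ E*_0 V`. -/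
def IsSplitBasis (Φ : LeonardSystem F V d) (b : Module.Basis (Fin (d + 1)) F V) : Prop :=
  ∃ u ∈ LinearMap.range (Φ.Estar 0), u ≠ 0 ∧ ∀ i, b i = Polynomial.aeval Φ.A (Φ.tau i) u

/-- `φ 1, …, φ d` is the first split sequence of `Φ`: with respect to a `Φ`-split basis, `A` is
lower bidiagonal with diagonal `θ_0, …, θ_d` and subdiagonal `1, …, 1`, and `A*` is upper
bidiagonal with diagonal `θ*_0, …, θ*_d` and superdiagonal `φ 1, …, φ d`.
The values of `φ` outside `1, …, d` play no role. -/
def IsFirstSplitSequence (Φ : LeonardSystem F V d) (φ : ℕ → F) : Prop :=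
  ∃ b : Module.Basis (Fin (d + 1)) F V, Φ.IsSplitBasis b ∧
    LinearMap.toMatrix b b Φ.A = Matrix.of (fun i j : Fin (d + 1) =>
      if i = j then Φ.eigenvalue i else if (i : ℕ) = (j : ℕ) + 1 then 1 else 0) ∧
    LinearMap.toMatrix b b Φ.Astar = Matrix.of (fun i j : Fin (d + 1) =>
      if i = j then Φ.dualEigenvalue i else if (j : ℕ) = (i : ℕ) + 1 then φ j else 0)

/-- `ϕ 1, …, ϕ d` is the second split sequence of `Φ`, i.e. the first split sequence of `Φ^⇓`. -/
def IsSecondSplitSequence (Φ : LeonardSystem F V d) (ϕ : ℕ → F) : Prop :=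
  Φ.ddown.IsFirstSplitSequence ϕ

/-- The zero diagonal space: the elements `X` of `Span {I, A*, A, A A*}` with
`E*_i X E*_i = 0` for `0 ≤ i ≤ d`. -/
def zeroDiagonalSpace (Φ : LeonardSystem F V d) : Submodule F (Module.End F V) where
  carrier := {X | X ∈ Submodule.span F {1, Φ.Astar, Φ.A, Φ.A * Φ.Astar} ∧
    ∀ i, Φ.Estar i * X * Φ.Estar i = 0}
  add_mem' := fun {X Y} hX hY =>
    ⟨add_mem hX.1 hY.1, fun i => by rw [mul_add, add_mul, hX.2 i, hY.2 i, add_zero]⟩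
  zero_mem' := ⟨zero_mem _, fun i => by rw [mul_zero, zero_mul]⟩
  smul_mem' := fun c X hX =>
    ⟨Submodule.smul_mem _ c hX.1, fun i => by
      rw [mul_smul_comm, smul_mul_assoc, hX.2 i, smul_zero]⟩

/-- Dual `q`-Hahn type. -/
def IsDualQHahn (Φ : LeonardSystem F V d) : Prop :=
  ∃ q h hs s r : F,
    (q ≠ 0 ∧ h ≠ 0 ∧ hs ≠ 0 ∧ s ≠ 0 ∧ r ≠ 0) ∧
    (∀ i : ℕ, 1 ≤ i → i ≤ d → q ^ i ≠ 1 ∧ r * q ^ i ≠ 1 ∧ s * q ^ i / r ≠ 1) ∧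
    (∀ i : ℕ, 2 ≤ i → i ≤ 2 * d → s * q ^ i ≠ 1) ∧
    (∀ i : Fin (d + 1),
      Φ.eigenvalue i = Φ.eigenvalue 0 +
        h * (1 - q ^ (i : ℕ)) * (1 - s * q ^ ((i : ℕ) + 1)) * q ^ (-(i : ℤ))) ∧
    (∀ i : Fin (d + 1),
      Φ.dualEigenvalue i = Φ.dualEigenvalue 0 + hs * (1 - q ^ (i : ℕ)) * q ^ (-(i : ℤ))) ∧
    Φ.IsFirstSplitSequence (fun i : ℕ =>
      h * hs * q ^ (1 - 2 * (i : ℤ)) * (1 - q ^ i) * (1 - q ^ ((i : ℤ) - d - 1)) *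
        (1 - r * q ^ i)) ∧
    Φ.IsSecondSplitSequence (fun i : ℕ =>
      h * hs * q ^ ((d : ℤ) + 2 - 2 * i) * (1 - q ^ i) * (1 - q ^ ((i : ℤ) - d - 1)) *
        (s - r * q ^ ((i : ℤ) - d - 1)))

/-- Quantum `q`-Krawtchouk type. -/
def IsQuantumQKrawtchouk (Φ : LeonardSystem F V d) : Prop :=
  ∃ q hs s r : F,
    (q ≠ 0 ∧ hs ≠ 0 ∧ s ≠ 0 ∧ r ≠ 0) ∧
    (∀ i : ℕ, 1 ≤ i → i ≤ d → q ^ i ≠ 1 ∧ s * q ^ i / r ≠ 1) ∧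
    (∀ i : Fin (d + 1),
      Φ.eigenvalue i = Φ.eigenvalue 0 - s * q * (1 - q ^ (i : ℕ))) ∧
    (∀ i : Fin (d + 1),
      Φ.dualEigenvalue i = Φ.dualEigenvalue 0 + hs * (1 - q ^ (i : ℕ)) * q ^ (-(i : ℤ))) ∧
    Φ.IsFirstSplitSequence (fun i : ℕ =>
      -(r * hs * q ^ (1 - (i : ℤ)) * (1 - q ^ i) * (1 - q ^ ((i : ℤ) - d - 1)))) ∧
    Φ.IsSecondSplitSequence (fun i : ℕ =>
      hs * q ^ ((d : ℤ) + 2 - 2 * i) * (1 - q ^ i) * (1 - q ^ ((i : ℤ) - d - 1)) *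
        (s - r * q ^ ((i : ℤ) - d - 1)))

/-- `q`-Krawtchouk type. -/
def IsQKrawtchouk (Φ : LeonardSystem F V d) : Prop :=
  ∃ q h hs ss : F,
    (q ≠ 0 ∧ h ≠ 0 ∧ hs ≠ 0 ∧ ss ≠ 0) ∧
    (∀ i : ℕ, 1 ≤ i → i ≤ d → q ^ i ≠ 1) ∧
    (∀ i : ℕ, 2 ≤ i → i ≤ 2 * d → ss * q ^ i ≠ 1) ∧
    (∀ i : Fin (d + 1),
      Φ.eigenvalue i = Φ.eigenvalue 0 + h * (1 - q ^ (i : ℕ)) * q ^ (-(i : ℤ))) ∧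
    (∀ i : Fin (d + 1),
      Φ.dualEigenvalue i = Φ.dualEigenvalue 0 +
        hs * (1 - q ^ (i : ℕ)) * (1 - ss * q ^ ((i : ℕ) + 1)) * q ^ (-(i : ℤ))) ∧
    Φ.IsFirstSplitSequence (fun i : ℕ =>
      h * hs * q ^ (1 - 2 * (i : ℤ)) * (1 - q ^ i) * (1 - q ^ ((i : ℤ) - d - 1))) ∧
    Φ.IsSecondSplitSequence (fun i : ℕ =>
      h * hs * ss * q * (1 - q ^ i) * (1 - q ^ ((i : ℤ) - d - 1)))

/-- Affine `q`-Krawtchouk type. -/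
def IsAffineQKrawtchouk (Φ : LeonardSystem F V d) : Prop :=
  ∃ q h hs r : F,
    (q ≠ 0 ∧ h ≠ 0 ∧ hs ≠ 0 ∧ r ≠ 0) ∧
    (∀ i : ℕ, 1 ≤ i → i ≤ d → q ^ i ≠ 1 ∧ r * q ^ i ≠ 1) ∧
    (∀ i : Fin (d + 1),
      Φ.eigenvalue i = Φ.eigenvalue 0 + h * (1 - q ^ (i : ℕ)) * q ^ (-(i : ℤ))) ∧
    (∀ i : Fin (d + 1),
      Φ.dualEigenvalue i = Φ.dualEigenvalue 0 + hs * (1 - q ^ (i : ℕ)) * q ^ (-(i : ℤ))) ∧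
    Φ.IsFirstSplitSequence (fun i : ℕ =>
      h * hs * q ^ (1 - 2 * (i : ℤ)) * (1 - q ^ i) * (1 - q ^ ((i : ℤ) - d - 1)) *
        (1 - r * q ^ i)) ∧
    Φ.IsSecondSplitSequence (fun i : ℕ =>
      -(h * hs * r * q ^ (1 - (i : ℤ)) * (1 - q ^ i) * (1 - q ^ ((i : ℤ) - d - 1))))

/-- Dual Hahn type. (The characteristic of a field is `0` or a prime.) -/
def IsDualHahn (Φ : LeonardSystem F V d) : Prop :=
  ∃ h s ss r : F,
    (h ≠ 0 ∧ ss ≠ 0) ∧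
    (ringChar F = 0 ∨ d < ringChar F) ∧
    (∀ i : ℕ, 1 ≤ i → i ≤ d → r ≠ -(i : F) ∧ s - r ≠ -(i : F)) ∧
    (∀ i : ℕ, 2 ≤ i → i ≤ 2 * d → s ≠ -(i : F)) ∧
    (∀ i : Fin (d + 1),
      Φ.eigenvalue i = Φ.eigenvalue 0 + h * ((i : ℕ) : F) * (((i : ℕ) : F) + 1 + s)) ∧
    (∀ i : Fin (d + 1),
      Φ.dualEigenvalue i = Φ.dualEigenvalue 0 + ss * ((i : ℕ) : F)) ∧
    Φ.IsFirstSplitSequence (fun i : ℕ =>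
      h * ss * (i : F) * ((i : F) - (d : F) - 1) * ((i : F) + r)) ∧
    Φ.IsSecondSplitSequence (fun i : ℕ =>
      h * ss * (i : F) * ((i : F) - (d : F) - 1) * ((i : F) + r - s - (d : F) - 1))

/-- Orphan type. -/
def IsOrphan (Φ : LeonardSystem F V d) : Prop :=
  d = 3 ∧ ringChar F = 2 ∧
  ∃ h hs s ss r : F,
    (h ≠ 0 ∧ hs ≠ 0 ∧ s ≠ 0 ∧ ss ≠ 0 ∧ r ≠ 0) ∧
    (s ≠ 1 ∧ ss ≠ 1) ∧
    (r ≠ s + ss ∧ r ≠ s * (1 + ss) ∧ r ≠ ss * (1 + s)) ∧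
    (Φ.eigenvalue 1 = Φ.eigenvalue 0 + h * (s + 1) ∧
      Φ.eigenvalue 2 = Φ.eigenvalue 0 + h ∧
      Φ.eigenvalue 3 = Φ.eigenvalue 0 + h * s) ∧
    (Φ.dualEigenvalue 1 = Φ.dualEigenvalue 0 + hs * (ss + 1) ∧
      Φ.dualEigenvalue 2 = Φ.dualEigenvalue 0 + hs ∧
      Φ.dualEigenvalue 3 = Φ.dualEigenvalue 0 + hs * ss) ∧
    (∃ φ : ℕ → F, Φ.IsFirstSplitSequence φ ∧
      φ 1 = h * hs * r ∧ φ 2 = h * hs ∧ φ 3 = h * hs * (r + s + ss)) ∧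
    (∃ ϕ : ℕ → F, Φ.IsSecondSplitSequence ϕ ∧
      ϕ 1 = h * hs * (r + s + s * ss) ∧ ϕ 2 = h * hs ∧ ϕ 3 = h * hs * (r + ss + s * ss))

end LeonardSystem

/-! In an eigenbasis of A*, the condition E*_i X E*_i = 0 says that the i-th diagonal entry of X
vanishes. If a_i denotes the i-th diagonal entry of A there, X = α + βA* + γA + δAA* yields the d +
1 ≥ 4 scalar equations α + βθ*_i + (γ + δθ*_i)a_i = 0, and it is enough that these force α = β = γ =
δ = 0 (`zeroDiagonalSpace_eq_bot`). The split basis supplies a_i = θ_i + c_i - c_{i+1}, where c_i =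
φ_i/(θ*_i - θ*_{i-1}) for 1 ≤ i ≤ d and c_0 = c_{d+1} = 0 (`toMatrix_diag_eq`).

For the dual q-Hahn, affine and quantum q-Krawtchouk types the equations become a cubic in q^i, and
for dual Hahn type a cubic in i, with d + 1 distinct roots. All its coefficients vanish
(`cubic_coeff_eq_zero`), and since the leading coefficient of a_i is nonzero the unknowns drop out
one at a time.

For q-Krawtchouk type, a_i is rational in T_i = q^{-i} + s* q^{i+1}. Clearing denominators gives a
cubic in T_i, but may multiply the equations at i = 0 and i = d by zero; these two are therefore
kept separately in cancelled form (`eq_zero_of_qKrawtchouk_system`). Orphan type is an explicit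
system of four equations in characteristic two. -/

namespace LeonardSystem

variable {F V : Type*} [Field F] [AddCommGroup V] [Module F V] {d : ℕ}

/-! ### Bidiagonal matrices and their eigenvectors. -/

/-- A matrix supported on the diagonal and the superdiagonal, applied to a vector. -/
theorem sum_upperBidiagonal (t x : Fin (d + 1) → F) (φ : ℕ → F) (j : Fin (d + 1)) :
    (∀ k : Fin (d + 1), (k : ℕ) = (j : ℕ) + 1 →
      ∑ l, (if j = l then t j else if (l : ℕ) = (j : ℕ) + 1 then φ l else 0) * x l =
        t j * x j + φ k * x k) ∧
    ((j : ℕ) = d →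
      ∑ l, (if j = l then t j else if (l : ℕ) = (j : ℕ) + 1 then φ l else 0) * x l =
        t j * x j) := by
  refine ⟨fun k hk => ?_, fun hj => ?_⟩
  · have hjk : j ≠ k := fun h => by rw [h] at hk; omega
    rw [Finset.sum_eq_add j k hjk]
    · rw [if_pos rfl, if_neg hjk, if_pos hk]
    · rintro l - ⟨h1, h2⟩
      rw [if_neg (Ne.symm h1), if_neg, zero_mul]
      exact fun h => h2 (Fin.ext (h.trans hk.symm))
    · simp
    · simp
  · rw [Finset.sum_eq_single j]
    · rw [if_pos rfl]
    · intro l _ h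
      rw [if_neg (Ne.symm h), if_neg, zero_mul]
      have := l.isLt
      omega
    · simp

/-- A matrix supported on the diagonal, with ones on the subdiagonal, applied to a vector. -/
theorem sum_lowerBidiagonal (t x : Fin (d + 1) → F) (j : Fin (d + 1)) :
    (∀ k : Fin (d + 1), (j : ℕ) = (k : ℕ) + 1 →
      ∑ l, (if j = l then t j else if (j : ℕ) = (l : ℕ) + 1 then 1 else 0) * x l =
        t j * x j + x k) ∧
    ((j : ℕ) = 0 →
      ∑ l, (if j = l then t j else if (j : ℕ) = (l : ℕ) + 1 then 1 else 0) * x l =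
        t j * x j) := by
  refine ⟨fun k hk => ?_, fun hj => ?_⟩
  · have hjk : j ≠ k := fun h => by rw [h] at hk; omega
    rw [Finset.sum_eq_add j k hjk]
    · rw [if_pos rfl, if_neg hjk, if_pos hk, one_mul]
    · rintro l - ⟨h1, h2⟩
      rw [if_neg (Ne.symm h1), if_neg, zero_mul]
      exact fun h => h2 (Fin.ext (by omega))
    · simp
    · simp
  · rw [Finset.sum_eq_single j]
    · rw [if_pos rfl]
    · intro l _ h
      rw [if_neg (Ne.symm h), if_neg, zero_mul]
      omega
    · simp

/-- The eigenvectors of a linear map that is upper bidiagonal with respect to a basis. -/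
theorem repr_eigenvector_upperBidiagonal {b : Module.Basis (Fin (d + 1)) F V}
    {B : Module.End F V} {t : Fin (d + 1) → F} {φ : ℕ → F} (ht : Function.Injective t)
    (hB : LinearMap.toMatrix b b B = Matrix.of (fun i j : Fin (d + 1) =>
      if i = j then t i else if (j : ℕ) = (i : ℕ) + 1 then φ j else 0))
    {i : Fin (d + 1)} {w : V} (hw : B w = t i • w) (hw0 : w ≠ 0) :
    (∀ j, i < j → b.repr w j = 0) ∧ b.repr w i ≠ 0 ∧
      ∀ j k : Fin (d + 1), (k : ℕ) = (j : ℕ) + 1 →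
        (t i - t j) * b.repr w j = φ k * b.repr w k := by
  have hrow : ∀ j, ∑ l, (if j = l then t j else if (l : ℕ) = (j : ℕ) + 1 then φ l else 0) *
      b.repr w l = t i * b.repr w j := by
    intro j
    have h := congrFun (LinearMap.toMatrix_mulVec_repr b b B w) j
    rw [hB, hw] at h
    simpa [Matrix.mulVec, dotProduct] using h
  have hrec : ∀ j k : Fin (d + 1), (k : ℕ) = (j : ℕ) + 1 →
      (t i - t j) * b.repr w j = φ k * b.repr w k := by
    intro j k hk
    have h := hrow j
    rw [(sum_upperBidiagonal t (b.repr w) φ j).1 k hk] at h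
    linear_combination -h
  have hlast : ∀ j : Fin (d + 1), (j : ℕ) = d → (t i - t j) * b.repr w j = 0 := by
    intro j hj
    have h := hrow j
    rw [(sum_upperBidiagonal t (b.repr w) φ j).2 hj] at h
    linear_combination -h
  -- Downward induction from row d over a successor-closed set `P` of indices. It is used for the
  -- indices above i, and then for all indices, where a zero i-th coordinate would force w = 0.
  have hdown : ∀ P : Fin (d + 1) → Prop, (∀ j, P j → (t i - t j) * b.repr w j = 0 →
      b.repr w j = 0) → (∀ j k : Fin (d + 1), (k : ℕ) = (j : ℕ) + 1 → P j → P k) →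
      ∀ n : ℕ, ∀ j : Fin (d + 1), (j : ℕ) + n = d → P j → b.repr w j = 0 := by
    intro P h1 h2 n
    induction n with
    | zero => exact fun j hj hP => h1 j hP (hlast j (by omega))
    | succ n ih =>
      intro j hj hP
      let k : Fin (d + 1) := ⟨j + 1, by omega⟩
      refine h1 j hP ?_
      rw [hrec j k rfl, ih k (by simp [k]; omega) (h2 j k rfl hP), mul_zero]
  have hgt : ∀ j, i < j → b.repr w j = 0 := by
    intro j hj
    refine hdown (fun j => i < j) (fun j hj h => ?_) (fun j k hk hj => ?_) (d - j) j
      (by have := j.isLt; omega) hj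
    · exact (mul_eq_zero.mp h).resolve_left
        (sub_ne_zero.mpr fun h => (ne_of_lt hj) (ht h))
    · rw [Fin.lt_def] at hj ⊢; omega
  refine ⟨hgt, fun hi => hw0 ?_, hrec⟩
  apply b.repr.map_eq_zero_iff.mp
  ext j
  refine hdown (fun _ => True) (fun j _ h => ?_) (fun _ _ _ _ => trivial) (d - j) j
      (by have := j.isLt; omega) trivial
  rcases eq_or_ne j i with rfl | hji
  · exact hi
  · exact (mul_eq_zero.mp h).resolve_left (sub_ne_zero.mpr fun h => hji (ht h).symm)

/-! ### Diagonal entries of A and reduction to scalar equations. -/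

/-- The diagonal entries of `A` in an eigenbasis of `A*`, in terms of the parameter array. -/
theorem toMatrix_diag_eq (Φ : LeonardSystem F V d) {φ c : ℕ → F}
    (hφ : Φ.IsFirstSplitSequence φ) (hc0 : c 0 = 0) (hcd : c (d + 1) = 0)
    (hc : ∀ j k : Fin (d + 1), (k : ℕ) = (j : ℕ) + 1 →
      c k * (Φ.dualEigenvalue k - Φ.dualEigenvalue j) = φ k)
    {w : Module.Basis (Fin (d + 1)) F V}
    (hw : ∀ i, Φ.Astar.HasEigenvector (Φ.dualEigenvalue i) (w i))
    (htri : IsIrreducibleTridiagonal (LinearMap.toMatrix w w Φ.A)) (i : Fin (d + 1)) :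
    LinearMap.toMatrix w w Φ.A i i = Φ.eigenvalue i + c i - c (i + 1) := by
  obtain ⟨b, -, hA, hB⟩ := hφ
  have hinj : Function.Injective Φ.dualEigenvalue := Φ.dualEigenvalue_spec.1.1.1
  have hx := fun i => repr_eigenvector_upperBidiagonal hinj hB
    (Module.End.HasEigenvector.apply_eq_smul (hw i)) (hw i).2
  set M := LinearMap.toMatrix w w Φ.A with hM
  -- The coefficient of b_j on both sides of A w_i = Σ_k M_{ki} w_k.
  have hrow : ∀ j, ∑ l, (if j = l then Φ.eigenvalue j else
      if (j : ℕ) = (l : ℕ) + 1 then 1 else 0) * b.repr (w i) l =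
      ∑ k, M k i * b.repr (w k) j := by
    intro j
    have h := congrFun (LinearMap.toMatrix_mulVec_repr b b Φ.A (w i)) j
    have h2 : Φ.A (w i) = ∑ k, M k i • w k := by
      conv_lhs => rw [← w.sum_repr (Φ.A (w i))]
      simp [hM, LinearMap.toMatrix_apply]
    rw [hA, h2] at h
    simpa [Matrix.mulVec, dotProduct] using h
  -- the left-hand side in row `i`
  have hleft : ∑ l, (if i = l then Φ.eigenvalue i else
      if (i : ℕ) = (l : ℕ) + 1 then 1 else 0) * b.repr (w i) l =
      (Φ.eigenvalue i + c i) * b.repr (w i) i := by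
    rcases Nat.eq_zero_or_pos (i : ℕ) with h0 | h0
    · rw [(sum_lowerBidiagonal Φ.eigenvalue (b.repr (w i)) i).2 h0, h0, hc0, add_zero]
    · let k : Fin (d + 1) := ⟨i - 1, by omega⟩
      have hk : (i : ℕ) = (k : ℕ) + 1 := by simp [k]; omega
      rw [(sum_lowerBidiagonal Φ.eigenvalue (b.repr (w i)) i).1 k hk]
      have h1 := (hx i).2.2 k i hk
      rw [← hc k i hk] at h1
      have hne : Φ.dualEigenvalue i - Φ.dualEigenvalue k ≠ 0 :=
        sub_ne_zero.mpr fun h => by have := hinj h; rw [← this] at hk; omega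
      have h2 : b.repr (w i) k = c i * b.repr (w i) i :=
        mul_left_cancel₀ hne (by linear_combination h1)
      rw [h2]; ring
  refine mul_right_cancel₀ (hx i).2.1 ?_
  have hri := hrow i
  rw [hleft] at hri
  rcases Nat.lt_or_ge (i : ℕ) d with hid | hid
  · let k : Fin (d + 1) := ⟨i + 1, by omega⟩
    have hk : (k : ℕ) = (i : ℕ) + 1 := rfl
    have hik : i ≠ k := fun h => by rw [← h] at hk; omega
    -- Only w_i and w_{i+1} contribute to b_i: earlier eigenvectors have no b_i coordinate, and
    -- later ones do not occur in A w_i by tridiagonality.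
    rw [Finset.sum_eq_add i k hik] at hri
    rotate_left
    · rintro l - ⟨h1, h2⟩
      rcases lt_or_gt_of_ne h1 with hl | hl
      · rw [(hx l).1 i hl, mul_zero]
      · have h2' : (l : ℕ) ≠ k := fun h => h2 (Fin.ext h)
        rw [Fin.lt_def] at hl
        rw [(htri l i).1 (Or.inr (by omega)), zero_mul]
    · simp
    · simp
    -- Row i + 1 expresses the unknown subdiagonal entry M_{i+1,i} through the coordinates of w_i
    -- and w_{i+1}, so that it can be eliminated from row i.
    have hrk := hrow k
    rw [(sum_lowerBidiagonal Φ.eigenvalue (b.repr (w i)) k).1 i hk,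
      (hx i).1 k (by rw [Fin.lt_def]; omega), Finset.sum_eq_single k] at hrk
    rotate_left
    · intro l _ h
      have h2' : (l : ℕ) ≠ k := fun h' => h (Fin.ext h')
      rcases lt_or_gt_of_ne h with hl | hl
      · rw [(hx l).1 k hl, mul_zero]
      · rw [Fin.lt_def] at hl
        rw [(htri l i).1 (Or.inr (by omega)), zero_mul]
    · simp
    have h1 := (hx k).2.2 i k hk
    rw [← hc i k hk] at h1
    have hne : Φ.dualEigenvalue k - Φ.dualEigenvalue i ≠ 0 :=
      sub_ne_zero.mpr fun h => hik (hinj h).symm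
    have h2 : b.repr (w k) i = c k * b.repr (w k) k :=
      mul_left_cancel₀ hne (by linear_combination h1)
    rw [h2] at hri
    rw [← hk]
    linear_combination -hri + c k * hrk
  · have hid' : (i : ℕ) = d := by omega
    rw [Finset.sum_eq_single i] at hri
    rotate_left
    · intro l _ h
      rw [(hx l).1 i, mul_zero]
      refine lt_of_le_of_ne ?_ h
      rw [Fin.le_def]; omega
    · simp
    have hci : c (i + 1) = 0 := by rw [hid', hcd]
    rw [hci]
    linear_combination -hri

/-- Every element of the zero diagonal space is a combination `α + β A* + γ A + δ A A*` whose
coefficients satisfy one linear relation for each `i`. -/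
theorem zeroDiagonalSpace_eq_bot (Φ : LeonardSystem F V d) {φ c : ℕ → F}
    (hφ : Φ.IsFirstSplitSequence φ) (hc0 : c 0 = 0) (hcd : c (d + 1) = 0)
    (hc : ∀ j k : Fin (d + 1), (k : ℕ) = (j : ℕ) + 1 →
      c k * (Φ.dualEigenvalue k - Φ.dualEigenvalue j) = φ k)
    (hind : ∀ α β γ δ : F, (∀ i : Fin (d + 1), α + β * Φ.dualEigenvalue i +
      (γ + δ * Φ.dualEigenvalue i) * (Φ.eigenvalue i + c i - c (i + 1)) = 0) →
      α = 0 ∧ β = 0 ∧ γ = 0 ∧ δ = 0) :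
    Φ.zeroDiagonalSpace = ⊥ := by
  rw [eq_bot_iff]
  rintro X ⟨hX, hXE⟩
  obtain ⟨⟨⟨hinj, -⟩, w, hw, htri⟩, hE⟩ := Φ.dualEigenvalue_spec
  simp only [Submodule.mem_span_insert, Submodule.mem_span_singleton] at hX
  obtain ⟨α, _, ⟨β, _, ⟨γ, _, ⟨δ, rfl⟩, rfl⟩, rfl⟩, rfl⟩ := hX
  have hEw : ∀ i j, Φ.Estar i (w j) = if i = j then w j else 0 := fun i j =>
    hE i j (w j) (hw j).1
  have hAw : ∀ i, Φ.Astar (w i) = Φ.dualEigenvalue i • w i := fun i =>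
    Module.End.HasEigenvector.apply_eq_smul (hw i)
  obtain ⟨rfl, rfl, rfl, rfl⟩ := hind α β γ δ fun i => by
    have h := LinearMap.congr_fun (hXE i) (w i)
    have hAi : Φ.Estar i (Φ.A (w i)) = LinearMap.toMatrix w w Φ.A i i • w i := by
      conv_lhs => rw [← w.sum_repr (Φ.A (w i)), map_sum]
      simp [hEw, LinearMap.toMatrix_apply, -Module.Basis.sum_repr]
    rw [toMatrix_diag_eq Φ hφ hc0 hcd hc hw htri i] at hAi
    simp only [Module.End.mul_apply, hEw, if_true, LinearMap.add_apply, LinearMap.smul_apply,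
      Module.End.one_apply, hAw, map_add, map_smul, hAi, LinearMap.zero_apply, smul_smul,
      ← add_smul] at h
    have h' := (smul_eq_zero.mp h).resolve_right (hw i).2
    linear_combination h'
  simp

/-! ### Types whose equations are cubic in q^i. -/

/-- A cubic polynomial with at least four distinct roots vanishes. -/
theorem cubic_coeff_eq_zero (hd : 3 ≤ d) {x : Fin (d + 1) → F} (hx : Function.Injective x)
    {a b c e : F} (h : ∀ i, a + b * x i + c * x i ^ 2 + e * x i ^ 3 = 0) :
    a = 0 ∧ b = 0 ∧ c = 0 ∧ e = 0 := by
  have hle : 4 ≤ d + 1 := by omega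
  have hv : ![a, b, c, e] = 0 :=
    Matrix.eq_zero_of_forall_index_sum_pow_mul_eq_zero
      (f := fun i : Fin 4 => x (Fin.castLE hle i))
      (fun i j hij => Fin.castLE_injective hle (hx hij)) (fun j => by
        have := h (Fin.castLE hle j)
        simp [Fin.sum_univ_four]
        linear_combination this)
  exact ⟨congrFun hv 0, congrFun hv 1, congrFun hv 2, congrFun hv 3⟩

theorem pow_val_injective {q : F} (hq : q ≠ 0) (hq1 : ∀ i : ℕ, 1 ≤ i → i ≤ d → q ^ i ≠ 1) :
    Function.Injective fun i : Fin (d + 1) => q ^ (i : ℕ) := by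
  have key : ∀ i j : Fin (d + 1), i < j → q ^ (i : ℕ) ≠ q ^ (j : ℕ) := by
    intro i j hij h
    rw [Fin.lt_def] at hij
    refine hq1 (j - i) (by omega) (by omega) (mul_left_cancel₀ (pow_ne_zero (i : ℕ) hq) ?_)
    rw [← pow_add, mul_one, h]
    congr 1
    omega
  intro i j hij
  rcases lt_trichotomy i j with h | h | h
  · exact absurd hij (key i j h)
  · exact h
  · exact absurd hij.symm (key j i h)

theorem zpow_neg_natCast' (q : F) (n : ℕ) : q ^ (-(n : ℤ)) = (q ^ n)⁻¹ := by
  rw [zpow_neg, zpow_natCast]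

theorem zpow_one_sub_natCast {q : F} (hq : q ≠ 0) (n : ℕ) :
    q ^ (1 - (n : ℤ)) = q / q ^ n := by
  rw [zpow_sub₀ hq, zpow_one, zpow_natCast]

theorem zpow_one_sub_two_mul {q : F} (hq : q ≠ 0) (n : ℕ) :
    q ^ (1 - 2 * (n : ℤ)) = q / (q ^ n) ^ 2 := by
  rw [zpow_sub₀ hq, zpow_one, mul_comm, zpow_mul, zpow_natCast]
  norm_cast

theorem zpow_sub_sub_one {q : F} (hq : q ≠ 0) (n d : ℕ) :
    q ^ ((n : ℤ) - d - 1) = q ^ n / q ^ (d + 1) := by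
  rw [sub_sub, zpow_sub₀ hq, zpow_natCast]
  norm_cast

/-- If the dual eigenvalues are affine in `q⁻ⁱ` and the diagonal coefficients are quadratic in
`qⁱ`, then the zero diagonal space is zero. -/
theorem zeroDiagonalSpace_eq_bot_of_quadratic (hd : 3 ≤ d) (Φ : LeonardSystem F V d)
    {φ c : ℕ → F} {q hs e b k : F} (hq : q ≠ 0) (hhs : hs ≠ 0) (hk : k ≠ 0)
    (hq1 : ∀ i : ℕ, 1 ≤ i → i ≤ d → q ^ i ≠ 1)
    (hθs : ∀ i : Fin (d + 1),
      Φ.dualEigenvalue i = Φ.dualEigenvalue 0 + hs * (1 - q ^ (i : ℕ)) * q ^ (-(i : ℤ)))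
    (hφ : Φ.IsFirstSplitSequence φ) (hc0 : c 0 = 0) (hcd : c (d + 1) = 0)
    (hc : ∀ n : ℕ, c n * (hs * (1 - q)) = φ n * q ^ n)
    (ha : ∀ i : Fin (d + 1), Φ.eigenvalue i + c i - c (i + 1) =
      e + b * q ^ (i : ℕ) + k * (q ^ (i : ℕ)) ^ 2) :
    Φ.zeroDiagonalSpace = ⊥ := by
  refine zeroDiagonalSpace_eq_bot Φ hφ hc0 hcd (fun j n hn => ?_) fun α β γ δ hrel => ?_
  · have hy : q ^ (j : ℕ) ≠ 0 := pow_ne_zero _ hq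
    have hcn := hc n
    rw [hθs n, hθs j, zpow_neg_natCast', zpow_neg_natCast']
    rw [hn, pow_succ] at hcn ⊢
    have : c (j + 1) = φ (j + 1) * (q ^ (j : ℕ) * q) / (hs * (1 - q)) := by
      rw [← hcn, mul_div_cancel_right₀]
      exact mul_ne_zero hhs (sub_ne_zero.mpr fun h => hq1 1 le_rfl (by omega) (by simp [← h]))
    have h1 : (1 - q) ≠ 0 := sub_ne_zero.mpr fun h => hq1 1 le_rfl (by omega) (by simp [← h])
    rw [this]
    field_simp
    ring
  · set t := Φ.dualEigenvalue 0
    -- With y = q^i and θ*_i = t - hs + hs/y, these are the coefficients of y times the i-th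
    -- relation. The top one gives γ + δ(t - hs) = 0, then the quadratic one gives δ = 0, the
    -- constant one β = 0, and the linear one α = 0.
    obtain ⟨h0, h1, h2, h3⟩ := cubic_coeff_eq_zero hd (pow_val_injective hq hq1)
      (a := β * hs + δ * hs * e)
      (b := α + β * (t - hs) + (γ + δ * (t - hs)) * e + δ * hs * b)
      (c := (γ + δ * (t - hs)) * b + δ * hs * k)
      (e := (γ + δ * (t - hs)) * k) fun i => by
        have h := hrel i
        have hy : q ^ (i : ℕ) ≠ 0 := pow_ne_zero _ hq
        rw [ha, hθs, zpow_neg_natCast'] at h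
        field_simp at h
        linear_combination h
    have hγ := (mul_eq_zero.mp h3).resolve_right hk
    rw [hγ] at h1 h2
    have hδ : δ = 0 := by simpa [hhs, hk] using h2
    subst hδ
    have hβ : β = 0 := by simpa [hhs] using h0
    subst hβ
    exact ⟨by simpa using h1, rfl, by simpa using hγ, rfl⟩

/-- The dual `q`-Hahn case and, for `s = 0`, the affine `q`-Krawtchouk case. -/
theorem zeroDiagonalSpace_eq_bot_of_dualQHahn_split (hd : 3 ≤ d) (Φ : LeonardSystem F V d)
    {q h hs s r : F} (hq : q ≠ 0) (hh : h ≠ 0) (hhs : hs ≠ 0) (hr : r ≠ 0)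
    (hq1 : ∀ i : ℕ, 1 ≤ i → i ≤ d → q ^ i ≠ 1)
    (hθ : ∀ i : Fin (d + 1), Φ.eigenvalue i = Φ.eigenvalue 0 +
      h * (1 - q ^ (i : ℕ)) * (1 - s * q ^ ((i : ℕ) + 1)) * q ^ (-(i : ℤ)))
    (hθs : ∀ i : Fin (d + 1),
      Φ.dualEigenvalue i = Φ.dualEigenvalue 0 + hs * (1 - q ^ (i : ℕ)) * q ^ (-(i : ℤ)))
    (hφ : Φ.IsFirstSplitSequence (fun i : ℕ =>
      h * hs * q ^ (1 - 2 * (i : ℤ)) * (1 - q ^ i) * (1 - q ^ ((i : ℤ) - d - 1)) *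
        (1 - r * q ^ i))) :
    Φ.zeroDiagonalSpace = ⊥ := by
  have h1 : 1 - q ≠ 0 := sub_ne_zero.mpr fun h => hq1 1 le_rfl (by omega) (by simp [← h])
  have h2 : 1 + q ≠ 0 := fun h => hq1 2 (by omega) (by omega) (by linear_combination (q - 1) * h)
  set M := q ^ (d + 1) with hM
  have hM0 : M ≠ 0 := pow_ne_zero _ hq
  -- With y = q^i, the 1/y term of θ_i cancels against that of c_i - c_{i+1}, leaving a quadratic in
  -- y. Its leading coefficient does not involve s and is nonzero because q² ≠ 1.
  refine zeroDiagonalSpace_eq_bot_of_quadratic hd Φ hq hhs (k := -(h * q * r * (1 + q) / M))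
    (e := Φ.eigenvalue 0 - h * (1 + s * q)) (b := h * s * q + h * q * (1 + r * M + r) / M)
    (c := fun n => h * q * (1 - q ^ n) * (M - q ^ n) * (1 - r * q ^ n) / (q ^ n * M * (1 - q)))
    ?_ hq1 hθs hφ (by simp) (by simp [hM]) (fun n => ?_) fun i => ?_
  · exact neg_ne_zero.mpr (div_ne_zero (by simp [*]) hM0)
  · have hy : q ^ n ≠ 0 := pow_ne_zero _ hq
    simp only [zpow_one_sub_two_mul hq, zpow_sub_sub_one hq, ← hM]
    field_simp
  · have hy : q ^ (i : ℕ) ≠ 0 := pow_ne_zero _ hq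
    rw [hθ, zpow_neg_natCast']
    simp only [pow_succ q (i : ℕ)]
    field_simp
    ring

theorem zeroDiagonalSpace_eq_bot_of_isDualQHahn (hd : 3 ≤ d) (Φ : LeonardSystem F V d)
    (hΦ : Φ.IsDualQHahn) : Φ.zeroDiagonalSpace = ⊥ := by
  obtain ⟨q, h, hs, s, r, ⟨hq, hh, hhs, -, hr⟩, hi, -, hθ, hθs, hφ, -⟩ := hΦ
  exact zeroDiagonalSpace_eq_bot_of_dualQHahn_split hd Φ hq hh hhs hr
    (fun i h1 h2 => (hi i h1 h2).1) hθ hθs hφ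

theorem zeroDiagonalSpace_eq_bot_of_isAffineQKrawtchouk (hd : 3 ≤ d) (Φ : LeonardSystem F V d)
    (hΦ : Φ.IsAffineQKrawtchouk) : Φ.zeroDiagonalSpace = ⊥ := by
  obtain ⟨q, h, hs, r, ⟨hq, hh, hhs, hr⟩, hi, hθ, hθs, hφ, -⟩ := hΦ
  exact zeroDiagonalSpace_eq_bot_of_dualQHahn_split (s := 0) hd Φ hq hh hhs hr
    (fun i h1 h2 => (hi i h1 h2).1) (by simpa using hθ) hθs hφ

/-- Here c_n is itself quadratic in q^n and θ_i is affine in q^i, so a_i is quadratic in q^i; the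
leading coefficient is nonzero because q² ≠ 1. -/
theorem zeroDiagonalSpace_eq_bot_of_isQuantumQKrawtchouk (hd : 3 ≤ d)
    (Φ : LeonardSystem F V d) (hΦ : Φ.IsQuantumQKrawtchouk) : Φ.zeroDiagonalSpace = ⊥ := by
  obtain ⟨q, hs, s, r, ⟨hq, hhs, -, hr⟩, hi, hθ, hθs, hφ, -⟩ := hΦ
  have hq1 := fun i h1 h2 => (hi i h1 h2).1
  have h1 : 1 - q ≠ 0 := sub_ne_zero.mpr fun h => hq1 1 le_rfl (by omega) (by simp [← h])
  have h2 : 1 + q ≠ 0 := fun h => hq1 2 (by omega) (by omega) (by linear_combination (q - 1) * h)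
  set M := q ^ (d + 1) with hM
  have hM0 : M ≠ 0 := pow_ne_zero _ hq
  refine zeroDiagonalSpace_eq_bot_of_quadratic hd Φ hq hhs (k := -(r * q * (1 + q) / M))
    (e := Φ.eigenvalue 0 - s * q) (b := s * q + r * q * (M + 1) / M)
    (c := fun n => -(r * q * (1 - q ^ n) * (M - q ^ n) / (M * (1 - q))))
    ?_ hq1 hθs hφ (by simp) (by simp [hM]) (fun n => ?_) fun i => ?_
  · exact neg_ne_zero.mpr (div_ne_zero (by simp [*]) hM0)
  · have hy : q ^ n ≠ 0 := pow_ne_zero _ hq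
    simp only [zpow_one_sub_natCast hq, zpow_sub_sub_one hq, ← hM]
    field_simp
  · rw [hθ]
    simp only [pow_succ q (i : ℕ)]
    field_simp
    ring

/-! ### Dual Hahn type. -/

/-- θ*_i is affine in i and a_i = e + bi - 2hi², so each relation is a cubic in i. The
characteristic assumption makes 0, …, d distinct in the field and 2 invertible. -/
theorem zeroDiagonalSpace_eq_bot_of_isDualHahn (hd : 3 ≤ d) (Φ : LeonardSystem F V d)
    (hΦ : Φ.IsDualHahn) : Φ.zeroDiagonalSpace = ⊥ := by
  obtain ⟨h, s, ss, r, ⟨hh, hss⟩, hchar, -, -, hθ, hθs, hφ, -⟩ := hΦ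
  have hcast : ∀ n : ℕ, 1 ≤ n → n ≤ d → (n : F) ≠ 0 := by
    intro n h1 h2 h0
    have hdvd := (ringChar.spec F n).mp h0
    rcases hchar with hc | hc
    · rw [hc, zero_dvd_iff] at hdvd
      omega
    · have := Nat.le_of_dvd h1 hdvd
      omega
  have h2 : (2 : F) ≠ 0 := by exact_mod_cast hcast 2 (by omega) (by omega)
  have hinj : Function.Injective fun i : Fin (d + 1) => ((i : ℕ) : F) := by
    have key : ∀ i j : Fin (d + 1), i < j → ((i : ℕ) : F) ≠ ((j : ℕ) : F) := by
      intro i j hij h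
      rw [Fin.lt_def] at hij
      refine hcast (j - i) (by omega) (by omega) ?_
      rw [Nat.cast_sub hij.le, h, sub_self]
    intro i j hij
    rcases lt_trichotomy i j with h | h | h
    · exact absurd hij (key i j h)
    · exact h
    · exact absurd hij.symm (key j i h)
  refine zeroDiagonalSpace_eq_bot Φ hφ
    (c := fun n => h * n * ((n : F) - d - 1) * ((n : F) + r)) (by simp) (by simp)
    (fun j n hn => ?_) fun α β γ δ hrel => ?_
  · rw [hθs n, hθs j, hn]
    push_cast
    ring
  · set t := Φ.dualEigenvalue 0
    set e := Φ.eigenvalue 0 + h * d * (1 + r) with he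
    set b := h * (s + 2 * d - 2 * r) with hb
    obtain ⟨h0, h1, h2', h3⟩ := cubic_coeff_eq_zero hd hinj
      (a := α + β * t + (γ + δ * t) * e)
      (b := β * ss + δ * ss * e + (γ + δ * t) * b)
      (c := δ * ss * b - (γ + δ * t) * (2 * h))
      (e := - (δ * ss * (2 * h))) fun i => by
        have hi := hrel i
        rw [hθ, hθs] at hi
        push_cast at hi
        rw [he, hb]
        linear_combination hi
    have hδ : δ = 0 := by simpa [hss, h2, hh] using h3
    subst hδ
    have hγ : γ = 0 := by simpa [h2, hh] using h2'
    subst hγ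
    have hβ : β = 0 := by simpa [hss] using h1
    subst hβ
    exact ⟨by simpa using h0, rfl, rfl, rfl⟩

/-! ### Orphan type. -/

/-- A linear system over a field of characteristic two with determinant one. -/
theorem eq_zero_of_charTwo_system {s t B G D : F} (h2 : (2 : F) = 0) (ht : t ≠ 0)
    (ht1 : 1 + t ≠ 0)
    (h1 : t * (t + 1) * B + (s * t + t + 1) * (G + (t + 1) * D) = 0)
    (h2' : t * (1 + t) * B + (1 + s * t) * (G + D) = 0)
    (h3 : (1 + t) * B + (s + 1) * (G + t * D) = 0) : B = 0 ∧ G = 0 ∧ D = 0 := by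
  -- B is eliminated using the third equation, once from the first and once from the second; the two
  -- resulting values of G differ by tD.
  have hG : G = (1 + s * t) * D := by
    linear_combination h1 - t * h3 - (t + s * t + 1) * D * h2
  have hG' : G = (1 + t + s * t) * D :=
    mul_left_cancel₀ ht1 (by
      linear_combination h2' - t * h3 + (t * G - (1 + t + s * t) * D) * h2)
  have hD : D = 0 := by
    have : t * D = 0 := by linear_combination hG - hG'
    exact (mul_eq_zero.mp this).resolve_left ht
  have hG0 : G = 0 := by rw [hG, hD, mul_zero]
  refine ⟨?_, hG0, hD⟩
  rw [hG0, hD] at h3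
  exact (mul_eq_zero.mp (by linear_combination h3)).resolve_left ht1

theorem zeroDiagonalSpace_eq_bot_of_isOrphan (Φ : LeonardSystem F V d)
    (hΦ : Φ.IsOrphan) : Φ.zeroDiagonalSpace = ⊥ := by
  obtain ⟨rfl, hchar, h, hs, s, t, r, ⟨hh, hhs, -, ht, -⟩, ⟨-, ht1'⟩, -, ⟨e1, e2, e3⟩,
    ⟨f1, f2, f3⟩, ⟨φ, hφ, p1, p2, p3⟩, -⟩ := hΦ
  have h2 : (2 : F) = 0 := by
    have := (ringChar.spec F 2).mpr (by rw [hchar])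
    exact_mod_cast this
  have ht1 : 1 + t ≠ 0 := fun h => ht1' (by linear_combination h - h2)
  set c : ℕ → F := fun n => if n = 1 then h * r / (1 + t) else if n = 2 then h / t else
    if n = 3 then h * (r + s + t) / (1 + t) else 0 with hcdef
  have hc : ∀ j k : Fin (3 + 1), (k : ℕ) = (j : ℕ) + 1 →
      c k * (Φ.dualEigenvalue k - Φ.dualEigenvalue j) = φ k := by
    intro j k hk
    fin_cases j <;> fin_cases k <;> simp at hk
    · show h * r / (1 + t) * (Φ.dualEigenvalue 1 - Φ.dualEigenvalue 0) = φ 1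
      rw [f1, p1]
      field_simp
      ring
    · show h / t * (Φ.dualEigenvalue 2 - Φ.dualEigenvalue 1) = φ 2
      rw [f1, f2, p2]
      field_simp
      linear_combination (-(hs * t)) * h2
    · show h * (r + s + t) / (1 + t) * (Φ.dualEigenvalue 3 - Φ.dualEigenvalue 2) = φ 3
      rw [f2, f3, p3]
      field_simp
      linear_combination (-(hs * (r + s + t))) * h2
  refine zeroDiagonalSpace_eq_bot Φ hφ (c := c) (by simp [c]) (by simp [c]) hc fun α β γ δ hrel => ?_
  set x := Φ.dualEigenvalue 0
  set y := Φ.eigenvalue 0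
  have r0 : α + β * x + (γ + δ * x) * (y + 0 - h * r / (1 + t)) = 0 := hrel 0
  have r1 : α + β * Φ.dualEigenvalue 1 + (γ + δ * Φ.dualEigenvalue 1) *
    (Φ.eigenvalue 1 + h * r / (1 + t) - h / t) = 0 := hrel 1
  have r2 : α + β * Φ.dualEigenvalue 2 + (γ + δ * Φ.dualEigenvalue 2) *
    (Φ.eigenvalue 2 + h / t - h * (r + s + t) / (1 + t)) = 0 := hrel 2
  have r3 : α + β * Φ.dualEigenvalue 3 + (γ + δ * Φ.dualEigenvalue 3) *
    (Φ.eigenvalue 3 + h * (r + s + t) / (1 + t) - 0) = 0 := hrel 3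
  rw [e1, f1] at r1
  rw [e2, f2] at r2
  rw [e3, f3] at r3
  -- e is a_0. In each difference a_i - a_0 the parameter r cancels in characteristic two, and
  -- subtracting multiples of `r0` removes α.
  set e := y + 0 - h * r / (1 + t) with he
  have a1 : y + h * (s + 1) + h * r / (1 + t) - h / t = e + h * ((s * t + t + 1) / t) := by
    rw [he]
    field_simp
    linear_combination h * (r * t - 1 - t) * h2
  have a2 : y + h + h / t - h * (r + s + t) / (1 + t) =
      e + h * ((1 + s * t) / (t * (1 + t))) := by
    rw [he]
    field_simp
    linear_combination h * (t - s * t) * h2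
  have a3 : y + h * s + h * (r + s + t) / (1 + t) - 0 =
      e + h * (t * (s + 1) / (1 + t)) := by
    rw [he]
    field_simp
    linear_combination h * (r + s) * h2
  rw [a1] at r1
  rw [a2] at r2
  rw [a3] at r3
  obtain ⟨hB, hG, hD⟩ := eq_zero_of_charTwo_system (s := s) (B := β * hs + δ * hs * e)
    (G := h * (γ + δ * x)) (D := h * hs * δ) h2 ht ht1
    (by
      have := congrArg (t * ·) r1
      field_simp at this
      linear_combination this - t * r0)
    (by
      have := congrArg (t * (1 + t) * ·) r2
      field_simp at this
      linear_combination this - t * (1 + t) * r0)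
    -- Since θ*_3 - θ*_0 and a_3 - a_0 both contain the factor t, the third difference is divided by
    -- t.
    (by
      have : t * ((1 + t) * (β * hs + δ * hs * e) +
          (s + 1) * (h * (γ + δ * x) + t * (h * hs * δ))) = 0 := by
        have := congrArg ((1 + t) * ·) r3
        field_simp at this
        linear_combination this - (1 + t) * r0
      exact (mul_eq_zero.mp this).resolve_left ht)
  have hδ : δ = 0 := by simpa [hh, hhs] using hD
  subst hδ
  have hγ : γ = 0 := by simpa [hh] using hG
  subst hγ
  have hβ : β = 0 := by simpa [hhs] using hB
  subst hβ
  exact ⟨by simpa using r0, rfl, rfl, rfl⟩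

/-! ### q-Krawtchouk type. -/

/-- The linear algebra behind the `q`-Krawtchouk case: the relations at `0`, at `d`, and the
relations `(a + b T) (T² - k) + m (g + e T) (p T + r) = 0` at all points force the coefficients
to vanish. Here `N = q⁻ᵈ⁻¹`. -/
theorem eq_zero_of_qKrawtchouk_system (hd : 3 ≤ d) {T : Fin (d + 1) → F}
    (hT : Function.Injective T) {q s m N a b g e : F} (hs : s ≠ 0) (hm : m ≠ 0)
    (hN : N ≠ 0) (hq1 : 1 + q ≠ 0) (hqN : q * N ≠ 1) (hsN : s = N ^ 2 → N ≠ 1)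
    (h0 : (a + b * (1 + s * q)) * (1 - s * q ^ 2) +
      m * (g + e * (1 + s * q)) * (N - s * q) = 0)
    (hdd : (a + b * (q * N + s / N)) * (q ^ 2 * N ^ 2 - s) +
      m * (g + e * (q * N + s / N)) * (N * (q * N - s)) = 0)
    (h : ∀ i, (a + b * T i) * (T i ^ 2 - s * (1 + q) ^ 2) +
      m * (g + e * T i) * ((N + s) * T i - s * (1 + N) * (1 + q)) = 0) :
    a = 0 ∧ b = 0 ∧ g = 0 ∧ e = 0 := by
  obtain ⟨c0, c1, c2, c3⟩ := cubic_coeff_eq_zero hd hT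
    (a := -(a * (s * (1 + q) ^ 2)) - m * g * (s * (1 + N) * (1 + q)))
    (b := -(b * (s * (1 + q) ^ 2)) + m * (g * (N + s) - e * (s * (1 + N) * (1 + q))))
    (c := a + m * e * (N + s)) (e := b) fun i => by linear_combination h i
  subst c3
  have ha : a = -(m * e * (N + s)) := by linear_combination c2
  subst ha
  have k1 : g * (N + s) = e * (s * (1 + N) * (1 + q)) :=
    mul_left_cancel₀ hm (by linear_combination c1)
  have k2 : g * (N - s * q) = e * (s * (1 + q) * (1 - q * N)) :=
    mul_left_cancel₀ hm (by linear_combination h0)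
  suffices he : e = 0 by
    subst he
    refine ⟨by ring, rfl, ?_, rfl⟩
    have : g * (s * (1 + q)) = 0 := by linear_combination k1 - k2
    exact (mul_eq_zero.mp this).resolve_right (mul_ne_zero hs hq1)
  -- The equations `k1`, `k2` in g and e have determinant proportional to s - N². In the degenerate
  -- case `k2` still determines g, and the relation at d kills e.
  by_cases hsN' : s = N ^ 2
  · have hN1 : 1 - N ≠ 0 := sub_ne_zero.mpr (hsN hsN').symm
    have hqN' : 1 - q * N ≠ 0 := sub_ne_zero.mpr hqN.symm
    subst hsN'
    have hg : g = e * (N * (1 + q)) :=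
      mul_right_cancel₀ (mul_ne_zero hN hqN') (by linear_combination k2)
    subst hg
    have hE : m * N ^ 3 * (1 + q) * (1 + q) * (1 - N) * e = 0 := by
      field_simp at hdd
      linear_combination hdd
    simpa [hm, hN, hq1, hN1] using hE
  · have hE : s * (1 + q) * (1 + q) * (s - N ^ 2) * e = 0 := by
      linear_combination (N - s * q) * k1 - (N + s) * k2
    simpa [hs, hq1, sub_ne_zero.mpr hsN'] using hE

/-- The coefficients `c i = φ i / (θ* i - θ* (i - 1))` in the `q`-Krawtchouk case, as a function
of `y = qⁱ`, where `M = qᵈ⁺¹`. -/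
def qKrawtchoukCoeff (q h s M y : F) : F :=
  h * q * (1 - y) * (M - y) / (y * M * (1 - q) * (1 - s * y ^ 2))

theorem qKrawtchoukCoeff_mul_sub {q h hs s M y : F} (hq : q ≠ 0) (hM : M ≠ 0) (h1 : 1 - q ≠ 0)
    (hy : y ≠ 0) (hd : 1 - s * (y * q) ^ 2 ≠ 0) (t : F) :
    qKrawtchoukCoeff q h s M (y * q) *
      (t + hs * ((y * q)⁻¹ + s * q * (y * q)) - (t + hs * (y⁻¹ + s * q * y))) =
    h * hs * (q / (y * q) ^ 2) * (1 - y * q) * (1 - y * q / M) := by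
  have e1 : t + hs * ((y * q)⁻¹ + s * q * (y * q)) - (t + hs * (y⁻¹ + s * q * y)) =
      hs * (1 - q) * (1 - s * (y * q) ^ 2) / (y * q) := by
    field_simp
    ring
  rw [e1, qKrawtchoukCoeff]
  -- Treating the denominator as an atom lets it cancel without being expanded.
  generalize 1 - s * (y * q) ^ 2 = D at hd ⊢
  field_simp

/-- The case i = 0, where c_0 = 0: only the denominator 1 - sq² of c_1 is cleared, so s = 1 is
allowed. -/
theorem qKrawtchouk_diag_first {q h s M : F} (hM : M ≠ 0) (h1 : 1 - q ≠ 0) (hq : q ≠ 0)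
    (hd : 1 - s * q ^ 2 ≠ 0) :
    (h - qKrawtchoukCoeff q h s M q) * (1 - s * q ^ 2) = h * q * (M⁻¹ - s * q) := by
  rw [qKrawtchoukCoeff, sub_mul]
  have e1 : h * q * (1 - q) * (M - q) / (q * M * (1 - q) * (1 - s * q ^ 2)) * (1 - s * q ^ 2) =
      h * (M - q) / M := by
    generalize 1 - s * q ^ 2 = D at hd ⊢
    field_simp
  rw [e1]
  field_simp
  ring

/-- The case y = q^d, where c_{d+1} = 0: only the denominator of c_d is cleared, so s q^{2d+2} = 1
is allowed. -/
theorem qKrawtchouk_diag_last {q h s y : F} (h1 : 1 - q ≠ 0) (hq : q ≠ 0) (hy : y ≠ 0)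
    (hd : 1 - s * y ^ 2 ≠ 0) :
    (h / y + qKrawtchoukCoeff q h s (y * q) y) * (y⁻¹ ^ 2 - s) =
      h * y⁻¹ * (y⁻¹ - s) := by
  have e1 : y⁻¹ ^ 2 - s = (1 - s * y ^ 2) / y ^ 2 := by field_simp
  have e2 : qKrawtchoukCoeff q h s (y * q) y * ((1 - s * y ^ 2) / y ^ 2) =
      -(h * (1 - y) / y ^ 3) := by
    rw [qKrawtchoukCoeff]
    generalize 1 - s * y ^ 2 = D at hd ⊢
    field_simp
    ring
  rw [e1, add_mul, e2]
  field_simp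
  ring

/-- With T = 1/y + sqy, the product of the denominators 1 - sy² and 1 - s(yq)², divided by y², is T²
- s(1 + q)². This is what makes the diagonal entry a rational function of T. -/
theorem qKrawtchouk_diag {q h s M y : F} (hM : M ≠ 0) (h1 : 1 - q ≠ 0) (hq : q ≠ 0)
    (hy : y ≠ 0) (hd : 1 - s * y ^ 2 ≠ 0) (hd' : 1 - s * (y * q) ^ 2 ≠ 0) :
    (h / y + qKrawtchoukCoeff q h s M y - qKrawtchoukCoeff q h s M (y * q)) *
        ((y⁻¹ + s * q * y) ^ 2 - s * (1 + q) ^ 2) =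
      h * q * ((M⁻¹ + s) * (y⁻¹ + s * q * y) - s * (1 + M⁻¹) * (1 + q)) := by
  have e0 : (y⁻¹ + s * q * y) ^ 2 - s * (1 + q) ^ 2 =
      (1 - s * y ^ 2) * (1 - s * (y * q) ^ 2) / y ^ 2 := by
    field_simp
    ring
  have e1 : qKrawtchoukCoeff q h s M y * ((1 - s * y ^ 2) * (1 - s * (y * q) ^ 2) / y ^ 2) =
      h * q * (1 - y) * (M - y) * (1 - s * (y * q) ^ 2) / (y ^ 3 * M * (1 - q)) := by
    rw [qKrawtchoukCoeff]
    generalize 1 - s * y ^ 2 = D at hd ⊢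
    field_simp
  have e2 : qKrawtchoukCoeff q h s M (y * q) *
        ((1 - s * y ^ 2) * (1 - s * (y * q) ^ 2) / y ^ 2) =
      h * (1 - y * q) * (M - y * q) * (1 - s * y ^ 2) / (y ^ 3 * M * (1 - q)) := by
    rw [qKrawtchoukCoeff]
    generalize 1 - s * (y * q) ^ 2 = D at hd' ⊢
    field_simp
  rw [e0, sub_mul, add_mul, e1, e2]
  field_simp
  ring

theorem zeroDiagonalSpace_eq_bot_of_isQKrawtchouk (hd : 3 ≤ d) (Φ : LeonardSystem F V d)
    (hΦ : Φ.IsQKrawtchouk) : Φ.zeroDiagonalSpace = ⊥ := by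
  obtain ⟨q, h, hs, s, ⟨hq, hh, hhs, hs0⟩, hq1, hs1, hθ, hθs, hφ, -⟩ := hΦ
  have h1 : 1 - q ≠ 0 := sub_ne_zero.mpr fun h => hq1 1 le_rfl (by omega) (by simp [← h])
  have h2 : 1 + q ≠ 0 := fun h => hq1 2 (by omega) (by omega) (by linear_combination (q - 1) * h)
  set M := q ^ (d + 1) with hM
  have hM0 : M ≠ 0 := pow_ne_zero _ hq
  have hMd : M = q ^ d * q := pow_succ q d
  clear_value M
  have hden : ∀ n : ℕ, 1 ≤ n → n ≤ d → 1 - s * (q ^ n) ^ 2 ≠ 0 := fun n hn hnd =>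
    sub_ne_zero.mpr fun h => hs1 (2 * n) (by omega) (by omega) (by
      rw [h, mul_comm 2 n, pow_mul])
  have hT : ∀ i : Fin (d + 1), Φ.dualEigenvalue i = Φ.dualEigenvalue 0 - hs * (1 + s * q) +
      hs * ((q ^ (i : ℕ))⁻¹ + s * q * q ^ (i : ℕ)) := by
    intro i
    have hy : q ^ (i : ℕ) ≠ 0 := pow_ne_zero _ hq
    rw [hθs i, zpow_neg_natCast', pow_succ]
    field_simp
    ring
  set c : ℕ → F := fun n => qKrawtchoukCoeff q h s M (q ^ n) with hcdef
  -- At both ends the numerator vanishes, so the quotient is 0 even if its denominator is 0 as well.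
  have hc0 : c 0 = 0 := by simp [c, qKrawtchoukCoeff]
  have hcd : c (d + 1) = 0 := by simp [c, hM, qKrawtchoukCoeff]
  refine zeroDiagonalSpace_eq_bot Φ hφ hc0 hcd (fun j k hk => ?_) fun α β γ δ hrel => ?_
  · have hy : q ^ (j : ℕ) ≠ 0 := pow_ne_zero _ hq
    have hdk := hden k (by omega) (by omega)
    simp only [hT k, hT j, hcdef, zpow_one_sub_two_mul hq, zpow_sub_sub_one hq, ← hM]
    rw [hk, pow_succ q (j : ℕ)] at hdk ⊢
    exact qKrawtchoukCoeff_mul_sub hq hM0 h1 hy hdk _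
  · set t := Φ.dualEigenvalue 0 - hs * (1 + s * q)
    set e := Φ.eigenvalue 0 - h with he
    -- T_i is distinct for distinct i because θ*_i is an affine function of it.
    have hTinj : Function.Injective fun i : Fin (d + 1) =>
        (q ^ (i : ℕ))⁻¹ + s * q * q ^ (i : ℕ) := by
      intro i j hij
      refine Φ.dualEigenvalue_spec.1.1.1 ?_
      rw [hT i, hT j]
      simp only at hij
      rw [hij]
    have hrel' : ∀ i : Fin (d + 1), (α + β * t + (γ + δ * t) * e) +
        (β * hs + δ * hs * e) * ((q ^ (i : ℕ))⁻¹ + s * q * q ^ (i : ℕ)) +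
        ((γ + δ * t) + δ * hs * ((q ^ (i : ℕ))⁻¹ + s * q * q ^ (i : ℕ))) *
          (h / q ^ (i : ℕ) + c i - c (i + 1)) = 0 := by
      intro i
      have hi := hrel i
      rw [hT i, hθ i, zpow_neg_natCast'] at hi
      have hy : q ^ (i : ℕ) ≠ 0 := pow_ne_zero _ hq
      have : Φ.eigenvalue 0 + h * (1 - q ^ (i : ℕ)) * (q ^ (i : ℕ))⁻¹ + c i - c (i + 1) =
          e + (h / q ^ (i : ℕ) + c i - c (i + 1)) := by
        rw [he]
        field_simp
        ring
      rw [this] at hi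
      linear_combination hi
    have hA0 : (h / q ^ 0 + c 0 - c (0 + 1)) * (1 - s * q ^ 2) = h * q * (M⁻¹ - s * q) := by
      have hd1 := hden 1 le_rfl (by omega)
      rw [pow_one] at hd1
      rw [hc0]
      simpa [hcdef] using qKrawtchouk_diag_first (h := h) hM0 h1 hq hd1
    have hMy : q * M⁻¹ = (q ^ d)⁻¹ := by
      rw [hMd, mul_inv, mul_comm, mul_assoc, inv_mul_cancel₀ hq, mul_one]
    have hMy' : s / M⁻¹ = s * q * q ^ d := by rw [div_inv_eq_mul, hMd]; ring
    have hAd : (h / q ^ d + c d - c (d + 1)) * (q ^ 2 * M⁻¹ ^ 2 - s) =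
        h * q * (M⁻¹ * (q * M⁻¹ - s)) := by
      have key := qKrawtchouk_diag_last (h := h) h1 hq (pow_ne_zero d hq)
        (hden d (by omega) le_rfl)
      rw [← hMd, ← hMy] at key
      rw [hcd, hcdef]
      linear_combination key
    have hA : ∀ n : ℕ, n ≤ d → (h / q ^ n + c n - c (n + 1)) *
        (((q ^ n)⁻¹ + s * q * q ^ n) ^ 2 - s * (1 + q) ^ 2) =
        h * q * ((M⁻¹ + s) * ((q ^ n)⁻¹ + s * q * q ^ n) - s * (1 + M⁻¹) * (1 + q)) := by
      intro n hn
      have hy : q ^ n ≠ 0 := pow_ne_zero _ hq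
      -- At the ends the uniform relation is the cancelled one times 1 - s, respectively 1 - sM²;
      -- either factor may be zero.
      rcases Nat.eq_zero_or_pos n with rfl | hn0
      · simp only [pow_zero, inv_one, mul_one] at hA0 ⊢
        linear_combination (1 - s) * hA0
      · rcases hn.lt_or_eq with hlt | rfl
        · have hd1 := hden n hn0 hn
          have hd2 := hden (n + 1) (by omega) hlt
          simp only [hcdef, pow_succ q n] at hd2 ⊢
          exact qKrawtchouk_diag hM0 h1 hq hy hd1 hd2
        · rw [← hMy', ← hMy]
          have hMM : M * M⁻¹ = 1 := mul_inv_cancel₀ hM0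
          rw [div_inv_eq_mul]
          generalize h / q ^ n + c n - c (n + 1) = A at hAd ⊢
          generalize M⁻¹ = N at hAd hMM ⊢
          linear_combination (1 - s * M ^ 2) * hAd + (A * (s * q ^ 2 * (M * N + 1) + 2 * q * s) -
            h * q * (s * q * (M * N + 1) + s - s ^ 2 * M)) * hMM
    obtain ⟨ha, hb, hg, hde⟩ := eq_zero_of_qKrawtchouk_system hd hTinj (m := h * q)
      (a := α + β * t + (γ + δ * t) * e) (b := β * hs + δ * hs * e) (g := γ + δ * t)
      (e := δ * hs) (N := M⁻¹) hs0 (mul_ne_zero hh hq) (inv_ne_zero hM0) h2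
      (fun h' => hq1 d (by omega) le_rfl (by rw [hMy] at h'; exact inv_eq_one.mp h'))
      -- If s = N² and N = 1, then s q^{d+1} = 1, which is excluded since 2 ≤ d + 1 ≤ 2d.
      (fun h1' h2' => hs1 (d + 1) (by omega) (by omega) (by
        rw [h1', ← hM, h2', inv_eq_one.mp h2']; ring))
      (by
        have h0 := hrel' 0
        simp only [Fin.val_zero, pow_zero, inv_one, mul_one] at h0 hA0
        linear_combination (1 - s * q ^ 2) * h0 - (γ + δ * t + δ * hs * (1 + s * q)) * hA0)
      (by
        have h0 := hrel' (Fin.last d)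
        simp only [Fin.val_last] at h0
        rw [← hMy, ← hMy'] at h0
        linear_combination (q ^ 2 * M⁻¹ ^ 2 - s) * h0 -
          (γ + δ * t + δ * hs * (q * M⁻¹ + s / M⁻¹)) * hAd)
      (fun i => by
        have h0 := hrel' i
        have hAi := hA i (by omega)
        linear_combination
          (((q ^ (i : ℕ))⁻¹ + s * q * q ^ (i : ℕ)) ^ 2 - s * (1 + q) ^ 2) * h0 -
          (γ + δ * t + δ * hs * ((q ^ (i : ℕ))⁻¹ + s * q * q ^ (i : ℕ))) * hAi)
    have hδ : δ = 0 := by simpa [hhs] using hde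
    subst hδ
    have hγ : γ = 0 := by simpa using hg
    subst hγ
    have hβ : β = 0 := by simpa [hhs] using hb
    subst hβ
    exact ⟨by simpa using ha, rfl, rfl, rfl⟩

end LeonardSystem

theorem theorem9p2 {F V : Type*} [Field F] [IsAlgClosed F] [AddCommGroup V] [Module F V]
    [FiniteDimensional F V] {d : ℕ} (hd : 3 ≤ d) (Φ : LeonardSystem F V d)
    (hΦ : Φ.IsDualQHahn ∨ Φ.IsQuantumQKrawtchouk ∨ Φ.IsQKrawtchouk ∨
      Φ.IsAffineQKrawtchouk ∨ Φ.IsDualHahn ∨ Φ.IsOrphan) :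
    Φ.zeroDiagonalSpace = ⊥ := by
  rcases hΦ with h | h | h | h | h | h
  · exact Φ.zeroDiagonalSpace_eq_bot_of_isDualQHahn hd h
  · exact Φ.zeroDiagonalSpace_eq_bot_of_isQuantumQKrawtchouk hd h
  · exact Φ.zeroDiagonalSpace_eq_bot_of_isQKrawtchouk hd h
  · exact Φ.zeroDiagonalSpace_eq_bot_of_isAffineQKrawtchouk hd h
  · exact Φ.zeroDiagonalSpace_eq_bot_of_isDualHahn hd h
  · exact Φ.zeroDiagonalSpace_eq_bot_of_isOrphan h
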